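/- Let $G$ be a group of order $80$ whose Sylow $5$-subgroups are not normal, and let $S \subseteq G$. Let $\mathrm{Cay}(G;S)$ be the Cayley graph of $G$ with respect to $S$, that is, the simple undirected graph with vertex set $G$ in which two distinct elements $u, v \in G$ are adjacent if and only if $v = us$ or $u = vs$ for some $s \in S$. If $\mathrm{Cay}(G;S)$ is connected (equivalently, if $S$ generates $G$), then $\mathrm{Cay}(G;S)$ has a hamiltonian cycle, i.e. a cycle that visits every element of $G$ exactly once. -/

import Mathlib

/-! There are 16 Sylow 5-subgroups, so each is its own normalizer, and Burnside's transfer theorem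
gives a normal complement `N` of order 16. A Sylow 5-subgroup is a maximal subgroup
(`closure_pair_eq_top`), so `N` is minimal normal, hence elementary abelian. Some `a ∈ S` lies
outside `N` and has order 5; some `b ∈ S` lies outside `⟨a⟩`, say `b = v * a ^ m` with `1 ≠ v ∈ N`.
The five conjugates of `v` under `a` generate `N` and have product 1, so up to isomorphism only `m`
matters. An explicit cycle in each of the five model graphs (`trail_word`) finishes the proof. -/

namespace Order80

/-- Translation of `𝔽₂⁴` by the `i`-th of the vectors `e₀, e₁, e₂, e₃, e₀ + e₁ + e₂ + e₃`. -/
def flip : Fin 5 → Bool × Bool × Bool × Bool → Bool × Bool × Bool × Bool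
  | 0, (p, q, r, s) => (!p, q, r, s)
  | 1, (p, q, r, s) => (p, !q, r, s)
  | 2, (p, q, r, s) => (p, q, !r, s)
  | 3, (p, q, r, s) => (p, q, r, !s)
  | 4, (p, q, r, s) => (!p, !q, !r, !s)

/-- The elements of `𝔽₂⁴ ⋊ C₅`, the generator of `C₅` permuting the five vectors of `flip`
cyclically. -/
abbrev Vertex := (Bool × Bool × Bool × Bool) × Fin 5

/-- Right multiplication by the generator `a` of `C₅`. -/
def Vertex.mulA (x : Vertex) : Vertex := (x.1, x.2 + 1)

/-- Right multiplication by `e₀ * a ^ m`. -/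
def Vertex.mulB (m : Fin 5) (x : Vertex) : Vertex := (flip x.2 x.1, x.2 + m)

inductive Letter
  | a
  | aInv
  | b
  | bInv

def Letter.act (m : Fin 5) : Letter → Vertex → Vertex
  | a, x => x.mulA
  | aInv, x => (x.1, x.2 - 1)
  | b, x => x.mulB m
  | bInv, x => (flip (x.2 - m) x.1, x.2 - m)

def Linked (m : Fin 5) (x y : Vertex) : Prop :=
  x ≠ y ∧ (x.mulA = y ∨ x = y.mulA ∨ x.mulB m = y ∨ x = y.mulB m)

instance (m : Fin 5) : DecidableRel (Linked m) := fun _ _ => by unfold Linked; infer_instance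

/-- The vertices visited by a word, starting from `x`, without the last one. -/
def trail (m : Fin 5) : List Letter → Vertex → List Vertex
  | [], _ => []
  | s :: w, x => x :: trail m w (s.act m x)

open Letter in
/-- A hamiltonian cycle for the generators `a` and `b = e₀ * a ^ m`. -/
def word : Fin 5 → List Letter
  | 0 => [a, b, aInv, aInv, b, aInv, b, aInv, aInv, b, a, b, aInv, aInv, aInv, aInv, b, aInv, b,
      aInv, aInv, aInv, aInv, b, a, a, b, a, a, b, a, b, aInv, b, a, b, a, b, a, a, b, aInv,
      aInv, b, aInv, b, a, a, b, a, a, b, a, b, aInv, aInv, aInv, aInv, b, a, a, b, a, b, a,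
      a, a, a, b, aInv, aInv, b, a, b, a, a, b, a, a, a]
  -- For `m ≠ 0`, the product of the 16-letter block lies outside `N`, so it has order 5, and left
  -- multiplication by it rotates the cycle.
  | 1 => (List.replicate 5
      [a, a, a, a, b, a, a, a, b, a, b, b, a, a, b, b]).flatten
  | 2 => (List.replicate 5
      [a, a, a, a, b, a, bInv, bInv, bInv, aInv, aInv, b, a, b, aInv, bInv]).flatten
  | 3 => (List.replicate 5
      [a, a, a, a, b, b, a, b, a, bInv, bInv, aInv, b, aInv, aInv, bInv]).flatten
  | 4 => (List.replicate 5
      [a, a, a, a, b, a, a, a, a, b, b, b, aInv, aInv, aInv, bInv]).flatten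

abbrev origin : Vertex := ((false, false, false, false), 0)

theorem trail_word (m : Fin 5) :
    (trail m (word m) origin).length = 80 ∧ (trail m (word m) origin).Nodup ∧
    (trail m (word m) origin ++ [origin]).IsChain (Linked m) := by
  revert m
  decide +kernel

end Order80

/-! ### Hamiltonian cycles from lists of vertices -/

namespace SimpleGraph

variable {α : Type*} {H : SimpleGraph α}

theorem exists_walk_support_eq {x y : α} {l : List α} (h : (x :: (l ++ [y])).IsChain H.Adj) :
    ∃ p : H.Walk x y, p.support = x :: (l ++ [y]) := by
  induction l generalizing x with
  | nil => exact ⟨.cons (by simpa using h) .nil, by simp⟩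
  | cons z l ih =>
    rw [List.cons_append, List.isChain_cons_cons] at h
    obtain ⟨p, hp⟩ := ih h.2
    exact ⟨.cons h.1 p, by simp [hp]⟩

theorem isHamiltonian_of_isChain [Fintype α] [DecidableEq α] {x : α} {l : List α}
    (hl : 2 ≤ l.length) (hcard : (x :: l).length = Fintype.card α) (hnodup : (x :: l).Nodup)
    (hchain : (x :: (l ++ [x])).IsChain H.Adj) : H.IsHamiltonian := by
  intro _
  obtain ⟨p, hp⟩ := exists_walk_support_eq hchain
  have hlen : p.length = Fintype.card α := by
    have := p.length_support
    simp only [hp, List.length_cons, List.length_append, List.length_nil] at this hcard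
    omega
  have hnil : ¬ p.Nil := by
    rw [Walk.not_nil_iff_lt_length, hlen, ← hcard]; simp
  refine ⟨x, p, Walk.isHamiltonianCycle_iff_isCycle_and_length_eq.2 ⟨?_, hlen⟩⟩
  -- The tail visits `l` and then `x`; a cycle needs length at least 3, whence `2 ≤ l.length`.
  refine Walk.isCycle_iff_isPath_tail_and_le_length.2 ⟨.mk' ?_, ?_⟩
  · rw [Walk.support_tail_of_not_nil _ hnil, hp, List.tail_cons]
    exact (List.perm_append_singleton x l).nodup_iff.2 hnodup
  · rw [hlen, ← hcard, List.length_cons]; omega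

end SimpleGraph

/-! ### Structure of the group -/

namespace Order80

open Subgroup

variable {G : Type*} [Group G] [Finite G]

instance : Fact (Nat.Prime 5) := ⟨by norm_num⟩

theorem factorization_five {d : ℕ} (hd : d ∣ 16) : (5 * d).factorization 5 = 1 := by
  have hd0 : d ≠ 0 := by rintro rfl; omega
  have h5 : ¬ 5 ∣ d := fun h => by have := h.trans hd; omega
  rw [Nat.factorization_mul (by norm_num) hd0, Finsupp.add_apply,
    Nat.factorization_eq_zero_of_not_dvd h5, Nat.Prime.factorization_self (by norm_num)]

theorem eq_one_or_sixteen {n d : ℕ} (hn : n ∣ d) (hd : d ∣ 16) (h : n ≡ 1 [MOD 5]) :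
    n = 1 ∨ n = 16 ∧ d = 16 := by
  have h1 : n ∈ Nat.divisors 16 := by simpa using hn.trans hd
  have h2 : d ∈ Nat.divisors 16 := by simpa using hd
  have e : Nat.divisors 16 = {1, 2, 4, 8, 16} := by decide
  rw [e] at h1 h2
  simp only [Finset.mem_insert, Finset.mem_singleton] at h1 h2
  rcases h1 with rfl | rfl | rfl | rfl | rfl <;> simp_all [Nat.ModEq]
  rcases h2 with rfl | rfl | rfl | rfl | rfl <;> simp_all

/-- A Sylow `5`-subgroup of a group of order `5 * d` with `d ∣ 16` is normal
or is its own normalizer, and the latter only when `d = 16`. -/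
theorem normal_or_normalizer_eq {d : ℕ} (hd : d ∣ 16) (hG : Nat.card G = 5 * d)
    {A : Subgroup G} (hA : Nat.card A = 5) :
    A.Normal ∨ d = 16 ∧ normalizer (A : Set G) = A := by
  have hpos : 0 < d := Nat.pos_of_ne_zero (by rintro rfl; omega)
  let P : Sylow 5 G := Sylow.ofCard A (by rw [hA, hG, factorization_five hd, pow_one])
  have hP : (P : Subgroup G) = A := rfl
  have hidx : A.index = d := by
    have := A.card_mul_index
    rw [hA, hG] at this
    omega
  have hdvd := P.card_dvd_index
  rw [hP, hidx] at hdvd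
  have hnorm := P.card_eq_index_normalizer
  change _ = (normalizer (A : Set G)).index at hnorm
  rcases eq_one_or_sixteen hdvd hd (card_sylow_modEq_one 5 G) with h | ⟨h, rfl⟩
  · left
    rw [← normalizer_eq_top_iff, ← index_eq_one, ← hnorm, h]
  · right
    refine ⟨rfl, (eq_of_le_of_card_ge le_normalizer ?_).symm⟩
    have := (normalizer (A : Set G)).card_mul_index
    rw [← hnorm, h, hG] at this
    omega

theorem normalizer_zpowers (hG : Nat.card G = 80)
    (hS : ∀ P : Sylow 5 G, ¬ (P : Subgroup G).Normal) {a : G} (ha : orderOf a = 5) :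
    normalizer (zpowers a : Set G) = zpowers a := by
  have hA : Nat.card (zpowers a) = 5 := by rw [Nat.card_zpowers, ha]
  rcases normal_or_normalizer_eq (d := 16) dvd_rfl hG hA with h | h
  · exact absurd h (hS (Sylow.ofCard (zpowers a)
      (by rw [hA, hG, show 80 = 5 * 16 by rfl, factorization_five dvd_rfl, pow_one])))
  · exact h.2

/-- If `K` had order below 80, `⟨a⟩` would be normal in `K`, so `z` would normalize `⟨a⟩`, which is
self-normalizing. -/
theorem closure_pair_eq_top (hG : Nat.card G = 80)
    (hS : ∀ P : Sylow 5 G, ¬ (P : Subgroup G).Normal) {a z : G} (ha : orderOf a = 5)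
    (hz : z ∉ zpowers a) : closure {a, z} = ⊤ := by
  set K := closure {a, z} with hK
  have haK : a ∈ K := subset_closure (by simp)
  have hzK : z ∈ K := subset_closure (by simp)
  have hle : zpowers a ≤ K := zpowers_le.2 haK
  have hA : Nat.card ((zpowers a).subgroupOf K) = 5 := by
    rw [Nat.card_congr (subgroupOfEquivOfLe hle).toEquiv, Nat.card_zpowers, ha]
  obtain ⟨d, hd⟩ : 5 ∣ Nat.card K := by
    rw [← ha]; exact orderOf_dvd_natCard (⟨a, haK⟩ : K) |> (by simpa using ·)
  have hd16 : d ∣ 16 := by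
    have := card_subgroup_dvd_card K
    rw [hd, hG, show 80 = 5 * 16 by rfl] at this
    exact Nat.dvd_of_mul_dvd_mul_left (by norm_num) this
  rcases normal_or_normalizer_eq hd16 hd hA with h | ⟨rfl, -⟩
  · rw [normal_subgroupOf_iff_le_normalizer hle, normalizer_zpowers hG hS ha] at h
    exact absurd (h hzK) hz
  · exact eq_top_of_card_eq _ (by rw [hd, hG])

theorem exists_normal_complement (hG : Nat.card G = 80)
    (hS : ∀ P : Sylow 5 G, ¬ (P : Subgroup G).Normal) {a : G} (ha : orderOf a = 5) :
    ∃ N : Subgroup G, N.Normal ∧ N.IsComplement' (zpowers a) := by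
  have hA : Nat.card (zpowers a) = 5 := by rw [Nat.card_zpowers, ha]
  let P : Sylow 5 G := Sylow.ofCard (zpowers a)
    (by rw [hA, hG, show 80 = 5 * 16 by rfl, factorization_five dvd_rfl, pow_one])
  have hP : (P : Subgroup G) = zpowers a := rfl
  have hcent : normalizer (P : Set G) ≤ centralizer (P : Set G) := by
    have := normalizer_zpowers hG hS ha
    change normalizer (zpowers a : Set G) ≤ centralizer (zpowers a : Set G)
    rw [this]
    exact le_centralizer _
  exact ⟨_, inferInstance, MonoidHom.ker_transferSylow_isComplement' P hcent⟩

variable {a : G} {N : Subgroup G}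

theorem card_complement {G : Type*} [Group G] {a : G} {N : Subgroup G}
    (hG : Nat.card G = 80) (ha : orderOf a = 5) (hN : N.IsComplement' (zpowers a)) :
    Nat.card N = 16 := by
  have := hN.card_mul_card
  rw [Nat.card_zpowers, ha, hG] at this
  omega

/-- `N` is a minimal normal subgroup. -/
theorem le_of_normal (hG : Nat.card G = 80)
    (hS : ∀ P : Sylow 5 G, ¬ (P : Subgroup G).Normal) (ha : orderOf a = 5)
    (hN : N.IsComplement' (zpowers a)) {H : Subgroup G} [hH : H.Normal] (hle : H ≤ N)
    (hne : H ≠ ⊥) : N ≤ H := by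
  obtain ⟨z, hzH, hz1⟩ := (bot_or_exists_ne_one H).resolve_left hne
  have hz : z ∉ zpowers a := fun h =>
    hz1 (by simpa using (disjoint_def.1 hN.disjoint) (hle hzH) h)
  have htop : zpowers a ⊔ H = ⊤ := by
    rw [eq_top_iff, ← closure_pair_eq_top hG hS ha hz, closure_le]
    rintro x (rfl | rfl)
    · exact mem_sup_left (mem_zpowers _)
    · exact mem_sup_right hzH
  intro x hx
  obtain ⟨y, hy, w, hw, rfl⟩ := mem_sup_of_normal_right.1 (htop ▸ mem_top x : x ∈ zpowers a ⊔ H)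
  have : y ∈ N := by simpa using N.mul_mem hx (N.inv_mem (hle hw))
  have : y = 1 := (disjoint_def.1 hN.disjoint) this hy
  simpa [this] using hw

theorem complement_commute (hG : Nat.card G = 80)
    (hS : ∀ P : Sylow 5 G, ¬ (P : Subgroup G).Normal) (ha : orderOf a = 5) [N.Normal]
    (hN : N.IsComplement' (zpowers a)) {x y : G} (hx : x ∈ N) (hy : y ∈ N) : x * y = y * x := by
  have hc := card_complement hG ha hN
  have : Fact (Nat.Prime 2) := ⟨Nat.prime_two⟩
  have : Nontrivial N := Finite.one_lt_card_iff_nontrivial.1 (by omega)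
  have := (IsPGroup.of_card (p := 2) (n := 4) (by rw [hc]; norm_num) :
    IsPGroup 2 N).center_nontrivial
  -- The center is characteristic in `N`, so normal in `G`, and minimality applies.
  have hle : N ≤ (center N).map N.subtype :=
    le_of_normal hG hS ha hN (map_subtype_le _) (by
      rw [Ne, map_eq_bot_iff_of_injective _ N.subtype_injective]
      exact (nontrivial_iff_ne_bot _).1 this)
  obtain ⟨x', hx', rfl⟩ := hle hx
  exact (congrArg Subtype.val (mem_center_iff.1 hx' ⟨y, hy⟩)).symm

theorem complement_mul_self (hG : Nat.card G = 80)
    (hS : ∀ P : Sylow 5 G, ¬ (P : Subgroup G).Normal) (ha : orderOf a = 5) [hn : N.Normal]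
    (hN : N.IsComplement' (zpowers a)) {x : G} (hx : x ∈ N) : x * x = 1 := by
  have hc := card_complement hG ha hN
  have hcomm {x y : G} (hx : x ∈ N) (hy : y ∈ N) := complement_commute hG hS ha hN hx hy
  let H : Subgroup G :=
    { carrier := {x | x ∈ N ∧ x * x = 1}
      one_mem' := ⟨N.one_mem, one_mul 1⟩
      mul_mem' := by
        rintro x y ⟨hx, hx2⟩ ⟨hy, hy2⟩
        refine ⟨N.mul_mem hx hy, ?_⟩
        rw [mul_assoc, ← mul_assoc y, hcomm hy hx, mul_assoc, hy2, mul_one, hx2]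
      inv_mem' := by
        rintro x ⟨hx, hx2⟩
        exact ⟨N.inv_mem hx, by rw [← mul_inv_rev, hx2, inv_one]⟩ }
  have : H.Normal := ⟨by
    rintro x ⟨hx, hx2⟩ g
    refine ⟨hn.conj_mem x hx g, ?_⟩
    rw [show g * x * g⁻¹ * (g * x * g⁻¹) = g * (x * x) * g⁻¹ by group, hx2, mul_one,
      mul_inv_cancel]⟩
  have : Fact (Nat.Prime 2) := ⟨Nat.prime_two⟩
  obtain ⟨t, ht⟩ := exists_prime_orderOf_dvd_card' (G := N) 2 (by omega)
  have hle : N ≤ H := le_of_normal hG hS ha hN (fun x hx => hx.1) (by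
    intro h
    have : (t : G) ∈ H := ⟨t.2, by
      rw [← pow_two, ← ht]
      exact_mod_cast congrArg Subtype.val (pow_orderOf_eq_one t)⟩
    rw [h, mem_bot, OneMemClass.coe_eq_one] at this
    simp [this] at ht)
  exact (hle hx).2

theorem eq_one_of_commute (hG : Nat.card G = 80)
    (hS : ∀ P : Sylow 5 G, ¬ (P : Subgroup G).Normal) (ha : orderOf a = 5)
    (hN : N.IsComplement' (zpowers a)) {x : G} (hx : x ∈ N) (h : Commute a x) : x = 1 := by
  refine disjoint_def.1 hN.disjoint hx ?_
  rw [← normalizer_zpowers hG hS ha]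
  refine centralizer_le_normalizer _ (mem_centralizer_iff.2 ?_)
  rintro y ⟨k, rfl⟩
  exact h.zpow_left k

/-- Here `g ^ 2` has order 5, so `⟨g ^ 2⟩` is self-normalizing; it contains `g`, which commutes with
`g ^ 2`. -/
theorem orderOf_eq_five_of_notMem (hG : Nat.card G = 80)
    (hS : ∀ P : Sylow 5 G, ¬ (P : Subgroup G).Normal) (ha : orderOf a = 5) [N.Normal]
    (hN : N.IsComplement' (zpowers a)) {g : G} (hg : g ∉ N) : orderOf g = 5 := by
  have hidx : N.index = 5 := by
    rw [hN.symm.index_eq_card, Nat.card_zpowers, ha]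
  have h5 : g ^ 5 ∈ N := hidx ▸ N.pow_index_mem g
  have h10 : (g ^ 2) ^ 5 = 1 := by
    rw [← complement_mul_self hG hS ha hN h5]; group
  have h2 : g ^ 2 ∉ N := fun h => hg (by
    have := N.mul_mem h5 (N.inv_mem (N.mul_mem h h))
    rwa [show g ^ 5 * (g ^ 2 * g ^ 2)⁻¹ = g by group] at this)
  have hc : orderOf (g ^ 2) = 5 := orderOf_eq_prime h10 fun h => h2 (h ▸ N.one_mem)
  have hmem : g ∈ zpowers (g ^ 2) := by
    rw [← normalizer_zpowers hG hS hc]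
    refine centralizer_le_normalizer _ (mem_centralizer_iff.2 ?_)
    rintro y ⟨k, rfl⟩
    exact ((Commute.refl g).pow_left 2).zpow_left k
  have : orderOf g ∣ 5 := by
    have := orderOf_dvd_natCard (⟨g, hmem⟩ : zpowers (g ^ 2))
    rwa [Nat.card_zpowers, hc, orderOf_mk] at this
  refine ((Nat.dvd_prime (by norm_num)).1 this).resolve_left fun h => hg ?_
  rw [orderOf_eq_one_iff.1 h]; exact N.one_mem

/-! ### Coordinates on the group -/

section Coordinates

variable {A : Type*} [Group A]

def coords (x : Fin 5 → A) (e : Bool × Bool × Bool × Bool) : A :=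
  x 0 ^ e.1.toNat * x 1 ^ e.2.1.toNat * x 2 ^ e.2.2.1.toNat * x 3 ^ e.2.2.2.toNat

theorem coords_flip {A : Type*} [CommGroup A] {x : Fin 5 → A} (hsq : ∀ i, x i * x i = 1)
    (hprod : x 0 * x 1 * x 2 * x 3 * x 4 = 1) (i : Fin 5) (e : Bool × Bool × Bool × Bool) :
    coords x (flip i e) = coords x e * x i := by
  have hpow (i : Fin 5) (p : Bool) : x i ^ (!p).toNat = x i ^ p.toNat * x i := by
    cases p <;> simp [hsq]
  have h4 : x 4 = x 0 * x 1 * x 2 * x 3 := by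
    rw [← mul_left_inj (x 4), hsq, hprod]
  obtain ⟨p, q, r, s⟩ := e
  fin_cases i <;> simp only [coords, flip, hpow, Fin.zero_eta, Fin.mk_one, Fin.reduceFinMk, h4] <;>
    ac_rfl

end Coordinates

variable {G : Type*} [Group G]

def conjPow (a v : G) (i : Fin 5) : G := a ^ i.val * v * (a ^ i.val)⁻¹

def toGroup (a v : G) (x : Vertex) : G := coords (conjPow a v) x.1 * a ^ x.2.val

theorem pow_val_add {a : G} (ha : orderOf a = 5) (i j : Fin 5) :
    a ^ (i + j).val = a ^ i.val * a ^ j.val := by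
  rw [Fin.val_add, ← pow_add]
  exact pow_eq_pow_iff_modEq.2 (by rw [ha]; exact Nat.mod_modEq _ 5)

theorem toGroup_mulA {a : G} (ha : orderOf a = 5) (v : G) (x : Vertex) :
    toGroup a v x.mulA = toGroup a v x * a := by
  simp [toGroup, Vertex.mulA, pow_val_add ha, mul_assoc]

section

variable {a v : G} {N : Subgroup G} [hn : N.Normal]

theorem conjPow_mem (hv : v ∈ N) (i : Fin 5) : conjPow a v i ∈ N := hn.conj_mem v hv _

variable [Finite G]

/-- Conjugation by `a` permutes the factors cyclically, so their product commutes with `a`; only 1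
in `N` does. -/
theorem prod_conjPow (hG : Nat.card G = 80)
    (hS : ∀ P : Sylow 5 G, ¬ (P : Subgroup G).Normal) (ha : orderOf a = 5)
    (hN : N.IsComplement' (zpowers a)) (hv : v ∈ N) :
    conjPow a v 0 * conjPow a v 1 * conjPow a v 2 * conjPow a v 3 * conjPow a v 4 = 1 := by
  have hm (i : Fin 5) : conjPow a v i ∈ N := conjPow_mem hv i
  have hsucc (i : Fin 5) : a * conjPow a v i = conjPow a v (i + 1) * a := by
    simp only [conjPow, pow_val_add ha, (Commute.refl a).pow_left _ |>.eq, Fin.val_one, pow_one]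
    group
  refine eq_one_of_commute hG hS ha hN
    (N.mul_mem (N.mul_mem (N.mul_mem (N.mul_mem (hm _) (hm _)) (hm _)) (hm _)) (hm _)) ?_
  have h : conjPow a v 1 * conjPow a v 2 * conjPow a v 3 * conjPow a v 4 * conjPow a v 0 =
      conjPow a v 0 * (conjPow a v 1 * conjPow a v 2 * conjPow a v 3 * conjPow a v 4) :=
    complement_commute hG hS ha hN
      (N.mul_mem (N.mul_mem (N.mul_mem (hm _) (hm _)) (hm _)) (hm _)) (hm _)
  have h0 := hsucc 0
  have h1 := hsucc 1
  have h2 := hsucc 2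
  have h3 := hsucc 3
  have h4 := hsucc 4
  simp only [Fin.reduceAdd, zero_add] at h0 h1 h2 h3 h4
  calc _ = a * conjPow a v 0 * conjPow a v 1 * conjPow a v 2 * conjPow a v 3 * conjPow a v 4 := by
        simp only [mul_assoc]
    _ = conjPow a v 1 * conjPow a v 2 * conjPow a v 3 * conjPow a v 4 * conjPow a v 0 * a := by
        simp only [h0, mul_assoc]
        rw [← mul_assoc a, h1, mul_assoc, ← mul_assoc a, h2, mul_assoc, ← mul_assoc a, h3,
          mul_assoc, h4]
    _ = _ := by rw [h]; simp only [mul_assoc]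

theorem toGroup_mulB (hG : Nat.card G = 80)
    (hS : ∀ P : Sylow 5 G, ¬ (P : Subgroup G).Normal) (ha : orderOf a = 5)
    (hN : N.IsComplement' (zpowers a)) (hv : v ∈ N) (m : Fin 5) (x : Vertex) :
    toGroup a v (x.mulB m) = toGroup a v x * (v * a ^ m.val) := by
  have hm (i : Fin 5) : conjPow a v i ∈ N := conjPow_mem hv i
  let _ : CommGroup N :=
    { (inferInstance : Group N) with
      mul_comm := fun x y => Subtype.ext (complement_commute hG hS ha hN x.2 y.2) }
  have h := congrArg Subtype.val (coords_flip (A := N) (x := fun i => ⟨conjPow a v i, hm i⟩)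
    (fun i => Subtype.ext (complement_mul_self hG hS ha hN (hm i)))
    (Subtype.ext (prod_conjPow hG hS ha hN hv)) x.2 x.1)
  have h' : coords (conjPow a v) (flip x.2 x.1) =
      coords (conjPow a v) x.1 * conjPow a v x.2 := h
  simp only [toGroup, Vertex.mulB, h', pow_val_add ha]
  simp only [conjPow]
  group

theorem toGroup_bijective (hG : Nat.card G = 80)
    (hS : ∀ P : Sylow 5 G, ¬ (P : Subgroup G).Normal) (ha : orderOf a = 5)
    (hN : N.IsComplement' (zpowers a)) (hv : v ∈ N) (hv1 : v ≠ 1) :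
    Function.Bijective (toGroup a v) := by
  have hsurj : Function.Surjective (toGroup a v) := by
    have hz : v ∉ zpowers a := fun h => hv1 ((disjoint_def.1 hN.disjoint) hv h)
    intro g
    -- By finiteness, inverses are not needed; `v` is the generator `b` with `m = 0`.
    have hg : g ∈ Submonoid.closure {a, v} := by
      rw [← closure_toSubmonoid_of_finite, closure_pair_eq_top hG hS ha hz]
      trivial
    induction hg using Submonoid.closure_induction_right with
    | one => exact ⟨origin, by simp [toGroup, coords]⟩
    | mul_right g _ y hy ih =>
      obtain ⟨x, rfl⟩ := ih
      rcases hy with rfl | rfl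
      · exact ⟨x.mulA, toGroup_mulA ha v x⟩
      · exact ⟨x.mulB 0, by simp [toGroup_mulB hG hS ha hN hv]⟩
  exact hsurj.bijective_of_nat_card_le (by rw [hG, Nat.card_eq_fintype_card]; decide)

end

/-! ### Transfer of the model cycle to the Cayley graph -/

theorem mulCayley_isHamiltonian_of_mem [Fintype G] [DecidableEq G] (hG : Nat.card G = 80)
    (hS : ∀ P : Sylow 5 G, ¬ (P : Subgroup G).Normal) {a v : G} (ha : orderOf a = 5)
    {N : Subgroup G} [N.Normal] (hN : N.IsComplement' (zpowers a)) (hv : v ∈ N) (hv1 : v ≠ 1)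
    (m : Fin 5) {S : Set G} (haS : a ∈ S) (hbS : v * a ^ m.val ∈ S) :
    (SimpleGraph.mulCayley S).IsHamiltonian := by
  have hf := toGroup_bijective hG hS ha hN hv hv1
  have hadj {x y : Vertex} (h : Linked m x y) :
      (SimpleGraph.mulCayley S).Adj (toGroup a v x) (toGroup a v y) := by
    rw [SimpleGraph.mulCayley_adj']
    refine ⟨hf.1.ne h.1, ?_⟩
    rcases h.2 with rfl | rfl | rfl | rfl
    · exact ⟨a, haS, .inl (toGroup_mulA ha v x).symm⟩
    · exact ⟨a, haS, .inr (toGroup_mulA ha v y)⟩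
    · exact ⟨_, hbS, .inl (toGroup_mulB hG hS ha hN hv m x).symm⟩
    · exact ⟨_, hbS, .inr (toGroup_mulB hG hS ha hN hv m y)⟩
  obtain ⟨hlen, hnodup, hchain⟩ := trail_word m
  obtain ⟨l, hl⟩ : ∃ l, trail m (word m) origin = origin :: l := by
    cases hw : word m with
    | nil => simp [hw, trail] at hlen
    | cons s w => exact ⟨_, rfl⟩
  rw [hl] at hlen hnodup hchain
  refine SimpleGraph.isHamiltonian_of_isChain (x := toGroup a v origin)
    (l := l.map (toGroup a v)) ?_ ?_ ?_ ?_
  · simp only [List.length_cons, List.length_map] at hlen ⊢; omega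
  · rw [← Nat.card_eq_fintype_card, hG, ← List.map_cons, List.length_map, hlen]
  · rw [← List.map_cons]; exact hnodup.map hf.1
  · have := (List.isChain_map (R := (SimpleGraph.mulCayley S).Adj) (toGroup a v)).2
      (hchain.imp fun _ _ h => hadj h)
    simpa using this

theorem closure_eq_top_of_connected {S : Set G} (h : (SimpleGraph.mulCayley S).Connected) :
    closure S = ⊤ := by
  rw [eq_top_iff]
  intro g _
  obtain ⟨p⟩ := h.preconnected 1 g
  suffices ∀ {x y : G}, (SimpleGraph.mulCayley S).Walk x y → x ∈ closure S → y ∈ closure S from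
    this p (one_mem _)
  intro x y p
  induction p with
  | nil => exact id
  | cons hxy _ ih =>
    refine fun hx => ih ?_
    obtain ⟨-, s, hs, rfl | rfl⟩ := (SimpleGraph.mulCayley_adj' S _ _).1 hxy
    · exact mul_mem hx (subset_closure hs)
    · exact (mul_mem_cancel_right (subset_closure hs)).1 hx

theorem mulCayley_isHamiltonian_of_connected {G : Type*} [Group G] [Fintype G] [DecidableEq G]
    (hcard : Fintype.card G = 80)
    (hsylow : ∀ P : Sylow 5 G, ¬ (P : Subgroup G).Normal)
    (S : Set G) (hconn : (SimpleGraph.mulCayley S).Connected) :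
    (SimpleGraph.mulCayley S).IsHamiltonian := by
  have hG : Nat.card G = 80 := by rw [Nat.card_eq_fintype_card, hcard]
  have hgen := closure_eq_top_of_connected hconn
  obtain ⟨c, hc⟩ := exists_prime_orderOf_dvd_card' (G := G) 5 (by omega)
  obtain ⟨N, hn, hN⟩ := exists_normal_complement hG hsylow hc
  have hcN := card_complement hG hc hN
  obtain ⟨a, haS, haN⟩ : ∃ a ∈ S, a ∉ N := by
    by_contra! h
    have htop : N = ⊤ := top_le_iff.1 (hgen ▸ (closure_le N).2 h)
    rw [htop, card_top, hG] at hcN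
    omega
  have ha := orderOf_eq_five_of_notMem hG hsylow hc hN haN
  -- `N` was built from `c`, but coprime orders make it a complement of `⟨a⟩` too.
  have hNa : N.IsComplement' (zpowers a) :=
    isComplement'_of_coprime (by rw [hcN, Nat.card_zpowers, ha, hG])
      (by rw [hcN, Nat.card_zpowers, ha]; decide)
  obtain ⟨b, hbS, hb⟩ : ∃ b ∈ S, b ∉ zpowers a := by
    by_contra! h
    have htop : zpowers a = ⊤ := top_le_iff.1 (hgen ▸ (closure_le (zpowers a)).2 h)
    have := Nat.card_zpowers a
    rw [htop, card_top, hG, ha] at this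
    omega
  obtain ⟨⟨⟨v, hv⟩, ⟨y, hy⟩⟩, rfl⟩ := hNa.2 b
  obtain ⟨m, hm, rfl⟩ := (mem_zpowers_iff_mem_range_orderOf (x := a)).1 hy |> Finset.mem_image.1
  rw [Finset.mem_range, ha] at hm
  exact mulCayley_isHamiltonian_of_mem hG hsylow ha hNa hv
    (fun h => hb (by simp [h, pow_mem])) ⟨m, hm⟩ haS hbS

end Order80

theorem proposition3p5 {G : Type*} [Group G] [Fintype G] [DecidableEq G]
    (hcard : Fintype.card G = 80)
    (hsylow : ∀ P : Sylow 5 G, ¬ (P : Subgroup G).Normal)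
    (S : Set G) (hconn : (SimpleGraph.mulCayley S).Connected) :
    (SimpleGraph.mulCayley S).IsHamiltonian :=
  Order80.mulCayley_isHamiltonian_of_connected hcard hsylow S hconn
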